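/- All vector spaces are finite-dimensional. A \emph{symplectic triple system} over a field $F$ is an $F$-vector space $T$ with a non-zero alternating bilinear form $(\cdot|\cdot)\colon T\times T\to F$ and a trilinear product $[\cdot,\cdot,\cdot]\colon T\times T\times T\to T$ such that, for all $x,y,z,u,v,w\in T$, \begin{gather*} [x,y,z]=[y,x,z],\qquad [x,y,z]-[x,z,y]=(x|z)y-(x|y)z+2(y|z)x,\\ [x,y,[u,v,w]]=[[x,y,u],v,w]+[u,[x,y,v],w]+[u,v,[x,y,w]],\qquad ([x,y,u]|v)=-(u|[x,y,v]). \end{gather*} It is \emph{simple} if $[T,T,T]\neq 0$ and the only subspaces $I$ with $[T,T,I]+[T,I,T]\subseteq I$ are $0$ and $T$. Its \emph{inner derivation algebra} $\mathfrak{inder}(T)\subseteq\mathfrak{gl}(T)$ is the linear span of the maps $d_{x,y}=[x,y,\cdot\,]$, $x,y\in T$; it is a Lie subalgebra of $\mathfrak{gl}(T)$. Let $F$ be a field of characteristic $0$, $\overline F$ an algebraic closure of $F$, and $T$ a simple symplectic triple system over $\overline F$. Let $\mathfrak s$ be a Lie algebra over $F$ with an isomorphism $\varphi\colon \overline F\otimes_F\mathfrak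 s\to\mathfrak{inder}(T)$ of Lie algebras over $\overline F$, and let $S$ be an $\mathfrak s$-module over $F$ with an $\overline F$-linear isomorphism $\Phi\colon\overline F\otimes_F S\to T$ such that $\Phi(x\cdot u)=\varphi(x)(\Phi(u))$ for all $x\in\overline F\otimes_F\mathfrak s$, $u\in\overline F\otimes_F S$. Then: (1) there are a non-degenerate alternating bilinear form $(\cdot|\cdot)\colon S\times S\to F$ and a trilinear product $[\cdot,\cdot,\cdot]\colon S\times S\times S\to S$ making $S$ a symplectic triple system over $F$ whose inner derivation algebra is equal to the image of $\mathfrak s$ in $\mathfrak{gl}(S)$; (2) the pair is unique up to a common scalar: a symplectic triple system structure $\bigl((\cdot|\cdot)',[\cdot,\cdot,\cdot]'\bigr)$ on $S$ has inner derivation algebra equal to the image of $\mathfrak s$ in $\mathfrak{gl}(S)$ if and only if there is $0\neq\alpha\in F$ with $(\cdot|\cdot)'=\alpha(\cdot|\cdot)$ and $[\cdot,\cdot,\cdot]'=\alpha[\cdot,\cdot,\cdot]$. -/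

import Mathlib

open scoped TensorProduct

-- `Module.End F T` carries the commutator bracket: it is the general linear Lie algebra `gl(T)`.
attribute [local instance 100] LieRing.ofAssociativeRing

/-- A symplectic triple system on the vector space `T` over `F`: a non-zero alternating bilinear
form `(x|y) = form x y` and a trilinear product `[x,y,z] = triple x y z` satisfying the four
defining identities. -/
structure SymplecticTripleSystem (F : Type*) (T : Type*) [Field F] [AddCommGroup T]
    [Module F T] where
  form : LinearMap.BilinForm F T
  triple : T →ₗ[F] T →ₗ[F] Module.End F T
  form_alt : ∀ x, form x x = 0
  form_ne_zero : form ≠ 0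
  triple_symm : ∀ x y z, triple x y z = triple y x z
  triple_sub : ∀ x y z,
    triple x y z - triple x z y = form x z • y - form x y • z + (2 * form y z) • x
  triple_derivation : ∀ x y u v w,
    triple x y (triple u v w) =
      triple (triple x y u) v w + triple u (triple x y v) w + triple u v (triple x y w)
  triple_skew : ∀ x y u v, form (triple x y u) v = -form u (triple x y v)

namespace SymplecticTripleSystem

variable {F T : Type*} [Field F] [AddCommGroup T] [Module F T]

/-- An ideal: a subspace `I` with `[T,T,I] + [T,I,T] ⊆ I`. -/
def IsIdeal (P : SymplecticTripleSystem F T) (I : Submodule F T) : Prop :=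
  ∀ x y, ∀ z ∈ I, P.triple x y z ∈ I ∧ P.triple x z y ∈ I

/-- Simplicity: `[T,T,T] ≠ 0` and the only ideals are `0` and `T`. -/
def IsSimple (P : SymplecticTripleSystem F T) : Prop :=
  P.triple ≠ 0 ∧ ∀ I : Submodule F T, P.IsIdeal I → I = ⊥ ∨ I = ⊤

/-- The linear span of the inner derivations `d_{x,y} = [x,y,·]`. -/
def innerSpan (P : SymplecticTripleSystem F T) : Submodule F (Module.End F T) :=
  Submodule.span F {d | ∃ x y : T, d = P.triple x y}

theorem innerSpan_lie_mem (P : SymplecticTripleSystem F T) {d e : Module.End F T}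
    (hd : d ∈ P.innerSpan) (he : e ∈ P.innerSpan) : ⁅d, e⁆ ∈ P.innerSpan := by
  unfold innerSpan at hd he ⊢
  induction hd using Submodule.span_induction with
  | mem d hd =>
    obtain ⟨x, y, rfl⟩ := hd
    induction he using Submodule.span_induction with
    | mem e he =>
      obtain ⟨u, v, rfl⟩ := he
      have h : ⁅P.triple x y, P.triple u v⁆ =
          P.triple (P.triple x y u) v + P.triple u (P.triple x y v) := by
        ext w
        simp [Ring.lie_def, P.triple_derivation x y u v w]
      rw [h]
      exact Submodule.add_mem _ (Submodule.subset_span ⟨_, _, rfl⟩)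
        (Submodule.subset_span ⟨_, _, rfl⟩)
    | zero => simp
    | add a b _ _ ha hb => rw [lie_add]; exact Submodule.add_mem _ ha hb
    | smul c a _ ha => rw [lie_smul]; exact Submodule.smul_mem _ c ha
  | zero => simp
  | add a b _ _ ha hb => rw [add_lie]; exact Submodule.add_mem _ ha hb
  | smul c a _ ha => rw [smul_lie]; exact Submodule.smul_mem _ c ha

/-- The inner derivation algebra, a Lie subalgebra of `gl(T)`. -/
def inder (P : SymplecticTripleSystem F T) : LieSubalgebra F (Module.End F T) :=
  { P.innerSpan with lie_mem' := fun hd he => P.innerSpan_lie_mem hd he }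

end SymplecticTripleSystem

/-! Two facts carry the theorem. Over an algebraically closed field, the alternating form is the
only invariant one up to scalars (`exists_eq_smul_form`). The triple product is then recovered from
the form and the Lie algebra: if `B` is the Killing form plus twice the trace form of the module,
`B(X, d_{x,y}) = -2(n+4)(X x|y)` with `n` the dimension of the module (`killingTraceForm_lift`), and
`B` is non-degenerate.

For existence, composing the form over `K` with an `F`-linear functional on `K` gives a non-zero
invariant `F`-valued form on `S`. By uniqueness it is a multiple of the original one, which can
therefore be rescaled to take values in `F` on `S`. Since `B` is defined over `F`, the identity
above then defines the inner derivations over `F`, and all axioms descend because `S` embeds in its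
scalar extension. The same two facts give uniqueness. -/

namespace SymplecticTripleSystem

/-! ### Identities, rescaling, transport and the radical of the form -/

section Basic

variable {k M : Type*} [Field k] [AddCommGroup M] [Module k M] (P : SymplecticTripleSystem k M)

theorem form_swap (x y : M) : P.form x y = -P.form y x :=
  (LinearMap.IsAlt.neg P.form_alt y x).symm

/-- Moving `t` to the last slot exhibits `t ↦ [t,y,x]` as an inner derivation plus a scalar and maps
of rank at most one, so that traces can be computed. -/
theorem triple_rotate (t y x : M) :
    P.triple t y x = P.triple y x t + P.form y x • t - P.form y t • x + (2 * P.form t x) • y := by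
  have h := P.triple_sub y t x
  rw [P.triple_symm t y x, eq_add_of_sub_eq h]
  module

/-- The quadrilinear map `([x,y,z]|w)` is invariant under exchanging the pairs `(x, y)` and
`(z, w)`. -/
theorem form_triple_pair_swap (x y z w : M) :
    P.form (P.triple x y z) w = P.form (P.triple z w x) y := by
  have h1 := congrArg (fun v => P.form v w) (P.triple_sub x y z)
  have h2 := P.triple_skew z x y w
  have h3 := P.form_swap y (P.triple z x w)
  have h4 := congrArg (fun v => P.form v y) (P.triple_sub z x w)
  simp only [map_sub, map_add, map_smul, LinearMap.sub_apply, LinearMap.add_apply,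
    LinearMap.smul_apply, smul_eq_mul] at h1 h4
  rw [P.triple_symm x z y] at h1
  linear_combination h1 + h2 - h3 + h4 + P.form y w * P.form_swap z x
    - P.form z x * P.form_swap w y + 2 * P.form x w * P.form_swap z y

/-- Two structures with proportional data have the same inner derivation algebra. -/
theorem inder_eq_of_smul {P P' : SymplecticTripleSystem k M} {α : k} (hα : α ≠ 0)
    (h : P'.triple = α • P.triple) : P'.inder = P.inder := by
  have key : ∀ {P P' : SymplecticTripleSystem k M} {α : k}, P'.triple = α • P.triple →
      P'.innerSpan ≤ P.innerSpan := by
    intro P P' α h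
    refine Submodule.span_le.2 ?_
    rintro _ ⟨x, y, rfl⟩
    rw [h]
    exact Submodule.smul_mem _ α (Submodule.subset_span ⟨x, y, rfl⟩)
  have h' : P.triple = α⁻¹ • P'.triple := by rw [h, inv_smul_smul₀ hα]
  exact SetLike.coe_injective (congrArg SetLike.coe (le_antisymm (key h) (key h')))

/-- Rescaling a symplectic triple system. -/
@[simps]
def smul (α : k) (hα : α ≠ 0) : SymplecticTripleSystem k M where
  form := α • P.form
  triple := α • P.triple
  form_alt x := by simp [P.form_alt]
  form_ne_zero := smul_ne_zero hα P.form_ne_zero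
  triple_symm x y z := by simp [P.triple_symm x y z]
  triple_sub x y z := by
    simp only [LinearMap.smul_apply, smul_eq_mul, ← smul_sub, P.triple_sub]
    module
  triple_derivation x y u v w := by
    simp only [LinearMap.smul_apply, map_smul, P.triple_derivation x y u v w]
    module
  triple_skew x y u v := by simp [P.triple_skew x y u v]

/-- Transport of a symplectic triple system along a linear equivalence. -/
@[simps]
def comap {N : Type*} [AddCommGroup N] [Module k N] (e : N ≃ₗ[k] M) :
    SymplecticTripleSystem k N where
  form := P.form.compl₁₂ e.toLinearMap e.toLinearMap
  triple := (P.triple.compl₁₂ e.toLinearMap e.toLinearMap).compr₂ e.symm.conj.toLinearMap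
  form_alt x := by simp [P.form_alt]
  form_ne_zero h := P.form_ne_zero <| by
    ext x y
    simpa using LinearMap.congr_fun₂ h (e.symm x) (e.symm y)
  triple_symm x y z := by simp [LinearEquiv.conj_apply, P.triple_symm (e x) (e y) (e z)]
  triple_sub x y z := by
    apply e.injective
    simp [LinearEquiv.conj_apply, P.triple_sub (e x) (e y) (e z)]
  triple_derivation x y u v w := by
    apply e.injective
    simp [LinearEquiv.conj_apply, P.triple_derivation (e x) (e y) (e u) (e v) (e w)]
  triple_skew x y u v := by simp [LinearEquiv.conj_apply, P.triple_skew (e x) (e y) (e u) (e v)]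

/-- Inner derivations are skew, hence preserve the radical; `triple_sub` then handles the middle
slot. Simplicity enters the main proof only through this ideal. -/
theorem isIdeal_ker_form : P.IsIdeal (LinearMap.ker P.form) := by
  intro x y z hz
  have hz' : ∀ v, P.form z v = 0 := fun v => by rw [LinearMap.mem_ker.1 hz]; rfl
  have h1 : P.triple x y z ∈ LinearMap.ker P.form := by
    refine LinearMap.mem_ker.2 (LinearMap.ext fun v => ?_)
    rw [P.triple_skew, hz', neg_zero, LinearMap.zero_apply]
  refine ⟨h1, ?_⟩
  have h := P.triple_sub x z y
  rw [hz', P.form_swap x z, hz'] at h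
  rw [eq_add_of_sub_eq h]
  exact Submodule.add_mem _ (by simpa using Submodule.smul_mem _ _ hz) h1

theorem IsSimple.ker_form {P : SymplecticTripleSystem k M} (hP : P.IsSimple) :
    LinearMap.ker P.form = ⊥ :=
  (hP.2 _ P.isIdeal_ker_form).resolve_right fun h =>
    P.form_ne_zero (LinearMap.ker_eq_top.1 h)

theorem form_nondegenerate {P : SymplecticTripleSystem k M} (h : LinearMap.ker P.form = ⊥) :
    P.form.Nondegenerate := by
  have h0 : ∀ x, (∀ y, P.form x y = 0) → x = 0 := fun x hx =>
    LinearMap.ker_eq_bot'.1 h x (LinearMap.ext hx)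
  exact ⟨h0, fun x hx => h0 x fun y => by rw [P.form_swap, hx, neg_zero]⟩

theorem form_apply_of_mem_inder {D : Module.End k M} (hD : D ∈ P.inder) (u v : M) :
    P.form (D u) v = -P.form u (D v) := by
  change D ∈ P.innerSpan at hD
  induction hD using Submodule.span_induction with
  | mem D hD => obtain ⟨x, y, rfl⟩ := hD; exact P.triple_skew x y u v
  | zero => simp
  | add a b _ _ ha hb => simp only [LinearMap.add_apply, map_add, ha, hb]; ring
  | smul c a _ ha => simp [ha]

theorem apply_triple_of_mem_inder {D : Module.End k M} (hD : D ∈ P.inder) (u v w : M) :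
    D (P.triple u v w) = P.triple (D u) v w + P.triple u (D v) w + P.triple u v (D w) := by
  change D ∈ P.innerSpan at hD
  induction hD using Submodule.span_induction with
  | mem D hD => obtain ⟨x, y, rfl⟩ := hD; exact P.triple_derivation x y u v w
  | zero => simp
  | add a b _ _ ha hb => simp only [LinearMap.add_apply, map_add, ha, hb]; abel
  | smul c a _ ha => simp [ha]

end Basic

/-! ### Uniqueness of the invariant alternating form -/

section FormUnique

variable {k M : Type*} [Field k] [CharZero k] [IsAlgClosed k] [AddCommGroup M] [Module k M]
  [FiniteDimensional k M] (P : SymplecticTripleSystem k M)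

/-- Over an algebraically closed field, the alternating forms invariant under the inner
derivation algebra are the multiples of the given one. -/
theorem exists_eq_smul_form (hP : P.form.Nondegenerate) (f : LinearMap.BilinForm k M)
    (hf : ∀ x, f x x = 0) (hinv : ∀ x y u v, f (P.triple x y u) v = -f u (P.triple x y v)) :
    ∃ c : k, f = c • P.form := by
  have hnt : Nontrivial M := by
    by_contra h
    rw [not_nontrivial_iff_subsingleton] at h
    exact P.form_ne_zero (LinearMap.ext fun x => by rw [Subsingleton.elim x 0]; simp)
  -- Subtracting an eigenvalue of the operator comparing the two forms makes the difference `g`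
  -- degenerate; the rest shows that a degenerate invariant `g` vanishes.
  let A₀ : Module.End k M := f.symmCompOfNondegenerate P.form hP
  obtain ⟨c, hc⟩ := Module.End.exists_eigenvalue A₀
  obtain ⟨x, hx⟩ := hc.exists_hasEigenvector
  refine ⟨c, ?_⟩
  let g : LinearMap.BilinForm k M := f - c • P.form
  have hg : ∀ x, g x x = 0 := fun x => by simp [g, hf, P.form_alt]
  have hginv : ∀ x y u v, g (P.triple x y u) v = -g u (P.triple x y v) := fun x y u v => by
    simp [g, hinv, P.triple_skew]; ring
  have hswap : ∀ u v, g u v = -g v u := fun u v => (LinearMap.IsAlt.neg hg v u).symm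
  have hA : ∃ A : Module.End k M, (∀ u v, P.form (A u) v = g u v) ∧ A x = 0 := by
    refine ⟨A₀ - c • 1, fun u v => ?_, ?_⟩
    · simp [g, A₀, LinearMap.BilinForm.symmCompOfNondegenerate_left_apply]
    · simp [hx.apply_eq_smul]
  obtain ⟨A, hA, hAx⟩ := hA
  have hself : ∀ u v, P.form (A u) v = P.form u (A v) := fun u v => by
    rw [hA, hswap, ← hA, P.form_swap (A v), neg_neg]
  have hext : ∀ {a b : M}, (∀ v, P.form a v = P.form b v) → a = b := fun {a b} h =>
    sub_eq_zero.1 (hP.1 _ fun v => by simp [h])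
  have hcomm : ∀ a b u, A (P.triple a b u) = P.triple a b (A u) := by
    refine fun a b u => hext fun v => ?_
    rw [hA, hginv, P.triple_skew, hA]
  have hx0 : ∀ v z, P.triple x (A v) z = 0 := by
    refine fun v z => hext fun w => ?_
    rw [P.form_triple_pair_swap, ← hself, hcomm, hAx]
    simp
  have hkey : ∀ v z, A (P.triple x v z) = (2 * P.form v (A z)) • x - P.form x v • A z := by
    intro v z
    have h := P.triple_sub x v (A z)
    rw [hx0, sub_zero, ← hself x, hAx, ← hcomm] at h
    rw [h]
    simp
    abel
  -- `A` is self-adjoint and commutes with the skew map `[x,v,·]`, so `(A[x,v,a]|b)` is symmetric in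
  -- `a, b`. By `hkey`, the case `a = z`, `b = v` reads `3(x|v)g(v,z) = -(x|v)g(v,z)`.
  have hxv : ∀ v z, P.form x v * g v z = 0 := by
    intro v z
    have h1 : ∀ a b, P.form (A (P.triple x v a)) b = P.form (A (P.triple x v b)) a := by
      intro a b
      rw [hself, P.triple_skew, ← hcomm, P.form_swap, neg_neg]
    have h2 := h1 z v
    simp only [hkey, map_sub, map_smul, LinearMap.sub_apply, LinearMap.smul_apply, smul_eq_mul,
      ← hself v, hA, hg, hswap z v] at h2
    linear_combination h2 / 4
  have hgv : ∀ v, P.form x v ≠ 0 → ∀ z, g v z = 0 := fun v hv z =>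
    (mul_eq_zero.1 (hxv v z)).resolve_left hv
  obtain ⟨v₀, hv₀⟩ : ∃ v, P.form x v ≠ 0 := by
    by_contra! h
    exact hx.2 (hP.1 x h)
  have : g = 0 := by
    -- The vectors outside the hyperplane orthogonal to `x` span the space.
    refine LinearMap.ext₂ fun v z => ?_
    by_cases hv : P.form x v = 0
    · have h := hgv (v + v₀) (by simpa [hv] using hv₀) z
      rwa [map_add, LinearMap.add_apply, hgv v₀ hv₀, add_zero] at h
    · exact hgv v hv z
  exact sub_eq_zero.1 this

end FormUnique
end SymplecticTripleSystem
-- The trace identity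
/-- For a module `M` over a Lie algebra `L`, the sum of the Killing form and twice the trace form
of `M`. -/
noncomputable def LieModule.killingTraceForm (k L M : Type*) [Field k] [LieRing L]
    [LieAlgebra k L] [AddCommGroup M] [Module k M] [LieRingModule L M] [LieModule k L M] :
    LinearMap.BilinForm k L :=
  killingForm k L + (2 : k) • LieModule.traceForm k L M

theorem LieModule.killingTraceForm_comm (k L M : Type*) [Field k] [LieRing L]
    [LieAlgebra k L] [AddCommGroup M] [Module k M] [LieRingModule L M] [LieModule k L M] (X Y : L) :
    killingTraceForm k L M X Y = killingTraceForm k L M Y X := by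
  simp [killingTraceForm, LieModule.traceForm_comm k L _ X Y]

namespace SymplecticTripleSystem

section TraceIdentity

variable {k L M : Type*} [Field k] [LieRing L] [LieAlgebra k L]
  [AddCommGroup M] [Module k M] [LieRingModule L M] [LieModule k L M] {P : SymplecticTripleSystem k M}

/-- If `L` acts faithfully with image the inner derivation algebra, the maps `[x,y,·]` lift
to `L`. -/
theorem exists_lift (hinj : Function.Injective (LieModule.toEnd k L M))
    (hr : P.inder = (LieModule.toEnd k L M).range) :
    ∃ δ : M →ₗ[k] M →ₗ[k] L, ∀ x y, LieModule.toEnd k L M (δ x y) = P.triple x y := by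
  have hmem : ∀ x y, P.triple x y ∈ LinearMap.range (LieModule.toEnd k L M : L →ₗ[k] Module.End k M) :=
    fun x y => by
      have : P.triple x y ∈ P.inder := Submodule.subset_span ⟨x, y, rfl⟩
      rw [hr] at this
      exact this
  let e := LinearEquiv.ofInjective (LieModule.toEnd k L M : L →ₗ[k] Module.End k M) hinj
  have he : ∀ z, LieModule.toEnd k L M (e.symm z) = z := fun z =>
    congrArg Subtype.val (e.apply_symm_apply z)
  refine ⟨LinearMap.mk₂ k (fun x y => e.symm ⟨P.triple x y, hmem x y⟩) ?_ ?_ ?_ ?_, fun x y => ?_⟩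
  · intro a b c
    apply hinj; simp [he]
  · intro a b c
    apply hinj; simp [he]
  · intro a b c
    apply hinj; simp [he]
  · intro a b c
    apply hinj; simp [he]
  · simp [he]

variable (hinj : Function.Injective (LieModule.toEnd k L M))
  (hr : P.inder = (LieModule.toEnd k L M).range)
  {δ : M →ₗ[k] M →ₗ[k] L} (hδ : ∀ x y, LieModule.toEnd k L M (δ x y) = P.triple x y)

theorem form_lie (hr : P.inder = (LieModule.toEnd k L M).range) (X : L) (u v : M) :
    P.form ⁅X, u⁆ v = -P.form u ⁅X, v⁆ :=
  P.form_apply_of_mem_inder (D := LieModule.toEnd k L M X) (hr ▸ ⟨X, rfl⟩) u v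

theorem form_lie_comm (hr : P.inder = (LieModule.toEnd k L M).range) (X : L) (u v : M) :
    P.form ⁅X, u⁆ v = P.form ⁅X, v⁆ u := by
  rw [form_lie hr, P.form_swap, neg_neg]

include hinj hr hδ in
theorem lie_lift (X : L) (x y : M) : ⁅X, δ x y⁆ = δ ⁅X, x⁆ y + δ x ⁅X, y⁆ := by
  apply hinj
  ext w
  have h := P.apply_triple_of_mem_inder (D := LieModule.toEnd k L M X) (hr ▸ ⟨X, rfl⟩) x y w
  rw [LieHom.map_lie, map_add, hδ, hδ, hδ]
  simp only [LieModule.toEnd_apply_apply] at h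
  simp [Ring.lie_def, h]

variable [FiniteDimensional k M]

-- The form identifies the module with its dual, turning `X` into minus its transpose.
include hr in
theorem trace_toEnd_eq_zero [CharZero k] (hP : P.form.Nondegenerate) (X : L) :
    LinearMap.trace k M (LieModule.toEnd k L M X) = 0 := by
  set D := LieModule.toEnd k L M X with hD
  have h : (P.form.toDual hP).conj D = -Module.Dual.transpose D := by
    ext f v
    obtain ⟨u, rfl⟩ := (P.form.toDual hP).surjective f
    simp [LinearEquiv.conj_apply, LinearMap.BilinForm.toDual_def, Module.Dual.transpose_apply, hD,
      form_lie hr]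
  have h' := LinearMap.trace_conj' D (P.form.toDual hP)
  rw [h, (map_neg (LinearMap.trace k (Module.Dual k M)) _ :), LinearMap.trace_transpose'] at h'
  linear_combination (-1 / 2 : k) * h'

variable [FiniteDimensional k L]

include hr hδ in
theorem trace_lie_lift_comp (htr : ∀ X : L, LinearMap.trace k M (LieModule.toEnd k L M X) = 0)
    (X : L) (x y : M) :
    LinearMap.trace k L (LieModule.toEnd k L L X ∘ₗ δ.flip y ∘ₗ
      (LieHom.toLinearMap (LieModule.toEnd k L M)).flip x) =
    LieModule.traceForm k L M X (δ x y) + (Module.finrank k M + 4) * P.form ⁅X, x⁆ y := by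
  -- Cyclicity replaces a trace on `L` by the trace on `M` of `t ↦ ⁅X, δ t y⁆ x`.
  rw [← LinearMap.comp_assoc, LinearMap.trace_comp_comm']
  have h : (LieHom.toLinearMap (LieModule.toEnd k L M)).flip x ∘ₗ (LieModule.toEnd k L L X ∘ₗ δ.flip y) =
      LieModule.toEnd k L M X ∘ₗ LieModule.toEnd k L M (δ x y)
        + P.form y x • LieModule.toEnd k L M X
        - (P.form y).smulRight ⁅X, x⁆ + (2 : k) • (LinearMap.flip P.form x).smulRight ⁅X, y⁆
        - LieModule.toEnd k L M (δ y ⁅X, x⁆) - P.form y ⁅X, x⁆ • LinearMap.id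
        + (P.form y).smulRight ⁅X, x⁆ - (2 : k) • (LinearMap.flip P.form ⁅X, x⁆).smulRight y := by
    ext t
    have ht : ∀ t x y, ⁅δ x y, t⁆ = P.triple x y t := fun t x y => LinearMap.congr_fun (hδ x y) t
    simp only [LinearMap.comp_apply, LinearMap.flip_apply, LieModule.toEnd_apply_apply,
      LieHom.coe_toLinearMap, LinearMap.add_apply, LinearMap.sub_apply, LinearMap.smul_apply,
      LinearMap.smulRight_apply, lie_lie, ht, LinearMap.id_apply]
    rw [P.triple_rotate t y x, P.triple_rotate t y ⁅X, x⁆, P.triple_symm y x]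
    simp only [lie_add, lie_sub, lie_smul]
    module
  rw [h]
  simp only [map_add, map_sub, map_smul, LinearMap.trace_smulRight, htr, LinearMap.trace_id,
    LinearMap.flip_apply, smul_eq_mul, LieModule.traceForm_apply_apply]
  have h1 := form_lie_comm hr X x y
  have h2 := P.form_swap y ⁅X, x⁆
  linear_combination (-2) * h1 + (-(Module.finrank k M : k) - 2) * h2

variable [CharZero k]

include hinj hr hδ in
/-- The sum of the Killing form and twice the trace form evaluated at an inner derivation. -/
theorem killingTraceForm_lift (hP : P.form.Nondegenerate) (X : L) (x y : M) :
    LieModule.killingTraceForm k L M X (δ x y) =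
      (-2 * (Module.finrank k M + 4)) * P.form ⁅X, x⁆ y := by
  have htr := trace_toEnd_eq_zero hr hP
  have hsymm : ∀ x y, δ x y = δ y x := fun x y => hinj <| by
    ext z; rw [hδ, hδ, P.triple_symm]
  -- Each of the two summands contributes `-tr(X d_{x,y})` to the Killing form; twice the trace form
  -- cancels exactly these.
  have h : LieModule.toEnd k L L X ∘ₗ LieModule.toEnd k L L (δ x y) =
      -(LieModule.toEnd k L L X ∘ₗ δ.flip y ∘ₗ (LieHom.toLinearMap (LieModule.toEnd k L M)).flip x)
      -(LieModule.toEnd k L L X ∘ₗ δ.flip x ∘ₗ (LieHom.toLinearMap (LieModule.toEnd k L M)).flip y) := by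
    ext E
    have h1 : ⁅δ x y, E⁆ = -(δ ⁅E, x⁆ y + δ ⁅E, y⁆ x) := by
      rw [← lie_skew, lie_lift hinj hr hδ, hsymm x]
    simp only [LinearMap.comp_apply, LinearMap.flip_apply, LieModule.toEnd_apply_apply,
      LieHom.coe_toLinearMap, LinearMap.sub_apply, LinearMap.neg_apply, h1, lie_neg, lie_add]
    abel
  rw [LieModule.killingTraceForm, LinearMap.add_apply, LinearMap.add_apply, killingForm,
    LieModule.traceForm_apply_apply k L L, h, map_sub, map_neg, trace_lie_lift_comp hr hδ htr,
    trace_lie_lift_comp hr hδ htr, form_lie_comm hr X y x, hsymm y x]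
  simp only [LinearMap.smul_apply, smul_eq_mul]
  ring

theorem neg_two_mul_finrank_add_four_ne_zero (k M : Type*) [Field k] [CharZero k]
    [AddCommGroup M] [Module k M] : (-2 * (Module.finrank k M + 4) : k) ≠ 0 := by
  refine mul_ne_zero (by norm_num) ?_
  exact_mod_cast (Module.finrank k M + 3).succ_ne_zero

-- Testing against `δ x y` gives `(Y x|y) = 0` for all `x, y`, so `Y` acts as zero, and the action
-- is faithful.
include hinj hr in
theorem eq_zero_of_killingTraceForm_eq_zero (hP : P.form.Nondegenerate) {Y : L}
    (hY : ∀ X, LieModule.killingTraceForm k L M X Y = 0) : Y = 0 := by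
  obtain ⟨δ, hδ⟩ := exists_lift hinj hr
  apply hinj
  ext x
  rw [map_zero, LinearMap.zero_apply]
  refine hP.1 _ fun y => ?_
  have h := hY (δ x y)
  rw [LieModule.killingTraceForm_comm, killingTraceForm_lift hinj hr hδ hP] at h
  exact (mul_eq_zero.1 h).resolve_left (neg_two_mul_finrank_add_four_ne_zero k M)

include hinj hr in
/-- The triple product is determined by the form and the inner derivation algebra. -/
theorem triple_eq_smul_of_form_eq_smul (hP : P.form.Nondegenerate)
    {P' : SymplecticTripleSystem k M} (hr' : P'.inder = (LieModule.toEnd k L M).range)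
    {α : k} (hP' : P'.form = α • P.form) (hα : α ≠ 0) : P'.triple = α • P.triple := by
  obtain ⟨δ, hδ⟩ := exists_lift hinj hr
  obtain ⟨δ', hδ'⟩ := exists_lift hinj hr'
  have hN : P'.form.Nondegenerate := by
    refine form_nondegenerate ?_
    rw [hP', LinearMap.ker_smul _ _ hα, hP.ker_eq_bot]
  ext x y : 2
  rw [← hδ', LinearMap.smul_apply, LinearMap.smul_apply, ← hδ, ← map_smul, ← sub_eq_zero,
    ← map_sub]
  rw [eq_zero_of_killingTraceForm_eq_zero hinj hr hP (Y := δ' x y - α • δ x y), map_zero]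
  intro X
  rw [map_sub, map_smul, killingTraceForm_lift hinj hr hδ hP,
    killingTraceForm_lift hinj hr' hδ' hN, hP', LinearMap.smul_apply, LinearMap.smul_apply,
    smul_eq_mul, smul_eq_mul]
  ring

end TraceIdentity

end SymplecticTripleSystem
-- Transport of inner derivations and descent to the base field
namespace SymplecticTripleSystem

theorem innerSpan_comap {k M N : Type*} [Field k] [AddCommGroup M] [Module k M]
    [AddCommGroup N] [Module k N] (P : SymplecticTripleSystem k M) (e : N ≃ₗ[k] M) :
    (P.comap e).innerSpan = P.innerSpan.map e.symm.conj.toLinearMap := by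
  unfold innerSpan
  rw [Submodule.map_span]
  congr 1
  ext D
  constructor
  · rintro ⟨x, y, rfl⟩
    exact ⟨_, ⟨e x, e y, rfl⟩, rfl⟩
  · rintro ⟨_, ⟨x, y, rfl⟩, rfl⟩
    exact ⟨e.symm x, e.symm y, by simp⟩

theorem ker_form_comap {k M N : Type*} [Field k] [AddCommGroup M] [Module k M]
    [AddCommGroup N] [Module k N] {P : SymplecticTripleSystem k M} (e : N ≃ₗ[k] M)
    (h : LinearMap.ker P.form = ⊥) : LinearMap.ker (P.comap e).form = ⊥ := by
  refine LinearMap.ker_eq_bot'.2 fun x hx => ?_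
  rw [← e.map_eq_zero_iff]
  refine LinearMap.ker_eq_bot'.1 h _ (LinearMap.ext fun y => ?_)
  simpa using LinearMap.congr_fun hx (e.symm y)

section Descent

variable {F K 𝔰 S : Type*} [Field F] [Field K] [Algebra F K]
  [LieRing 𝔰] [LieAlgebra F 𝔰] [AddCommGroup S] [Module F S] [LieRingModule 𝔰 S]
  [LieModule F 𝔰 S]

theorem one_tmul_injective (F K S : Type*) [Field F] [Field K] [Algebra F K] [AddCommGroup S]
    [Module F S] : Function.Injective fun u : S => (1 : K) ⊗ₜ[F] u :=
  Module.FaithfullyFlat.tensorProduct_mk_injective S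

theorem toEnd_injective_of_baseChange
    (h : Function.Injective (LieModule.toEnd K (K ⊗[F] 𝔰) (K ⊗[F] S))) :
    Function.Injective (LieModule.toEnd F 𝔰 S) := by
  intro X Y hXY
  refine one_tmul_injective F K 𝔰 (h ?_)
  rw [LieModule.toEnd_baseChange, LieModule.toEnd_baseChange, hXY]

/-- A bilinear form on a scalar extension is determined by its values on the original space. -/
theorem bilin_ext {f g : LinearMap.BilinForm K (K ⊗[F] S)}
    (h : ∀ u v, f (1 ⊗ₜ u) (1 ⊗ₜ v) = g (1 ⊗ₜ u) (1 ⊗ₜ v)) : f = g := by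
  ext u v
  simpa using h u v

theorem killingTraceForm_baseChange [FiniteDimensional F 𝔰] [FiniteDimensional F S] (X Y : 𝔰) :
    LieModule.killingTraceForm K (K ⊗[F] 𝔰) (K ⊗[F] S) (1 ⊗ₜ X) (1 ⊗ₜ Y) =
      algebraMap F K (LieModule.killingTraceForm F 𝔰 S X Y) := by
  have h1 := LieModule.traceForm_baseChange F 𝔰 S K
  have h2 := LieModule.traceForm_baseChange F 𝔰 𝔰 K
  simp [LieModule.killingTraceForm, killingForm, h1, h2, Algebra.smul_def, map_ofNat (algebraMap F K) 2]

variable [CharZero F] [CharZero K] [FiniteDimensional F S]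
  {P : SymplecticTripleSystem K (K ⊗[F] S)}

/-- An alternating form on `S` invariant under `𝔰` is proportional, after scalar extension, to the
form of `P`. -/
theorem exists_algebraMap_eq_mul_form [IsAlgClosed K] (hP : P.form.Nondegenerate)
    (hr : P.inder = (LieModule.toEnd K (K ⊗[F] 𝔰) (K ⊗[F] S)).range)
    (f : LinearMap.BilinForm F S) (hf : ∀ u, f u u = 0)
    (hinv : ∀ (X : 𝔰) u v, f ⁅X, u⁆ v = -f u ⁅X, v⁆) :
    ∃ c : K, ∀ u v, algebraMap F K (f u v) = c * P.form (1 ⊗ₜ u) (1 ⊗ₜ v) := by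
  have h1 : ∀ u v, f.baseChange K ((1 : K) ⊗ₜ u) (1 ⊗ₜ v) = algebraMap F K (f u v) := fun u v => by
    simp [Algebra.smul_def]
  -- Being alternating is quadratic and cannot be checked on pure tensors; skew-symmetry can, and
  -- suffices in characteristic 0.
  have hsw : f.baseChange K = -LinearMap.flip (f.baseChange K) := by
    refine bilin_ext fun u v => ?_
    rw [LinearMap.neg_apply, LinearMap.neg_apply, LinearMap.flip_apply, h1, h1, ← map_neg]
    exact congrArg _ (LinearMap.IsAlt.neg hf v u).symm
  have halt : ∀ x, f.baseChange K x x = 0 := fun x => by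
    have h := LinearMap.congr_fun₂ hsw x x
    rw [LinearMap.neg_apply, LinearMap.neg_apply, LinearMap.flip_apply] at h
    exact self_eq_neg.1 h
  have hinv' : ∀ (X : K ⊗[F] 𝔰) (u v : K ⊗[F] S),
      f.baseChange K (LieModule.toEnd K (K ⊗[F] 𝔰) (K ⊗[F] S) X u) v =
        -f.baseChange K u (LieModule.toEnd K (K ⊗[F] 𝔰) (K ⊗[F] S) X v) := by
    intro X
    induction X using TensorProduct.induction_on with
    | zero => simp
    | tmul a X =>
      have : (f.baseChange K) ∘ₗ LieModule.toEnd K (K ⊗[F] 𝔰) (K ⊗[F] S) (a ⊗ₜ X) =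
          -(f.baseChange K).compl₂ (LieModule.toEnd K (K ⊗[F] 𝔰) (K ⊗[F] S) (a ⊗ₜ X)) := by
        refine bilin_ext fun u v => ?_
        simp [hinv]
      intro u v
      exact LinearMap.congr_fun₂ this u v
    | add X Y hX hY =>
      intro u v
      simp only [map_add, LinearMap.add_apply, hX, hY, neg_add]
  obtain ⟨c, hc⟩ := P.exists_eq_smul_form hP (f.baseChange K) halt fun x y u v => by
    have hmem : P.triple x y ∈ P.inder := Submodule.subset_span ⟨x, y, rfl⟩
    rw [hr] at hmem
    obtain ⟨X, hX⟩ := hmem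
    rw [← hX]
    exact hinv' X u v
  refine ⟨c, fun u v => ?_⟩
  rw [← h1, hc]
  rfl

/-- After rescaling, the form of `P` takes values in `F` on `S`. -/
theorem exists_smul_form_mem [IsAlgClosed K] (hP : P.form.Nondegenerate)
    (hr : P.inder = (LieModule.toEnd K (K ⊗[F] 𝔰) (K ⊗[F] S)).range) :
    ∃ (f : LinearMap.BilinForm F S) (c : K), c ≠ 0 ∧ (∀ u, f u u = 0) ∧
      ∀ u v, algebraMap F K (f u v) = c * P.form (1 ⊗ₜ u) (1 ⊗ₜ v) := by
  obtain ⟨u₀, v₀, h₀⟩ : ∃ u v, P.form ((1 : K) ⊗ₜ[F] u) (1 ⊗ₜ v) ≠ 0 := by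
    by_contra! h
    exact P.form_ne_zero (bilin_ext h)
  -- Elements of `𝔰` map `S` to itself, so composing with any `F`-linear functional preserves
  -- invariance; this one keeps the form non-zero.
  obtain ⟨l, hl⟩ : ∃ l : Module.Dual F K, l (P.form ((1 : K) ⊗ₜ[F] u₀) (1 ⊗ₜ v₀)) ≠ 0 := by
    by_contra! h
    exact h₀ ((Module.forall_dual_apply_eq_zero_iff F _).1 h)
  let f : LinearMap.BilinForm F S :=
    LinearMap.mk₂ F (fun u v => l (P.form ((1 : K) ⊗ₜ[F] u) (1 ⊗ₜ v)))
      (fun u v w => by simp [TensorProduct.tmul_add])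
      (fun a u v => by simp [TensorProduct.tmul_smul])
      (fun u v w => by simp [TensorProduct.tmul_add])
      (fun a u v => by simp [TensorProduct.tmul_smul])
  have hf : ∀ u, f u u = 0 := fun u => by simp [f, P.form_alt]
  obtain ⟨c, hc⟩ := exists_algebraMap_eq_mul_form hP hr f hf fun X u v => by
    have h := form_lie hr ((1 : K) ⊗ₜ[F] X) (1 ⊗ₜ u) (1 ⊗ₜ v)
    simp only [LieAlgebra.ExtendScalars.bracket_tmul, mul_one] at h
    simp [f, h]
  refine ⟨f, c, fun h => ?_, hf, hc⟩
  have h' := hc u₀ v₀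
  rw [h, zero_mul, map_eq_zero] at h'
  exact hl h'

/-- A system on `K ⊗ S` whose form takes values in `F` on `S` descends to `S`. -/
theorem exists_descent [FiniteDimensional F 𝔰] (hP : P.form.Nondegenerate)
    (hinj : Function.Injective (LieModule.toEnd K (K ⊗[F] 𝔰) (K ⊗[F] S)))
    (hr : P.inder = (LieModule.toEnd K (K ⊗[F] 𝔰) (K ⊗[F] S)).range)
    (f : LinearMap.BilinForm F S)
    (hf : ∀ u v, algebraMap F K (f u v) = P.form (1 ⊗ₜ u) (1 ⊗ₜ v)) :
    ∃ Q : SymplecticTripleSystem F S, Q.form = f ∧ Q.form.Nondegenerate ∧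
      Q.inder = (LieModule.toEnd F 𝔰 S).range := by
  have hι := one_tmul_injective F K S
  have hinj' := toEnd_injective_of_baseChange hinj
  set B := LieModule.killingTraceForm F 𝔰 S with hBdef
  have hBcomm : ∀ X Y, B X Y = B Y X := LieModule.killingTraceForm_comm F 𝔰 S
  have hzero : ∀ Y : K ⊗[F] 𝔰, (∀ X : 𝔰,
      LieModule.killingTraceForm K (K ⊗[F] 𝔰) (K ⊗[F] S) (1 ⊗ₜ X) Y = 0) → Y = 0 := by
    refine fun Y hY => eq_zero_of_killingTraceForm_eq_zero hinj hr hP fun X => ?_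
    induction X using TensorProduct.induction_on with
    | zero => simp
    | tmul a X =>
      rw [← mul_one a, ← smul_eq_mul, ← TensorProduct.smul_tmul', map_smul, LinearMap.smul_apply,
        hY, smul_zero]
    | add X Y hX hY => rw [map_add, LinearMap.add_apply, hX, hY, add_zero]
  have hB0 : ∀ Y, (∀ X, B X Y = 0) → Y = 0 := by
    refine fun Y hY => one_tmul_injective F K 𝔰 ?_
    simp only [TensorProduct.tmul_zero]
    exact hzero _ fun X => by rw [killingTraceForm_baseChange, ← hBdef, hY, map_zero]
  have hB : B.Nondegenerate := ⟨fun Y hY => hB0 Y fun X => by rw [hBcomm, hY], hB0⟩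
  -- The constant of `killingTraceForm_lift`; the dimension is unchanged by scalar extension.
  let c : F := -2 * (Module.finrank F S + 4)
  have hc : c ≠ 0 := neg_two_mul_finrank_add_four_ne_zero F S
  let g : S →ₗ[F] S →ₗ[F] Module.Dual F 𝔰 :=
    LinearMap.mk₂ F (fun u v =>
        c • (LinearMap.flip f v ∘ₗ (LieHom.toLinearMap (LieModule.toEnd F 𝔰 S)).flip u))
      (fun u v w => by ext; simp; ring)
      (fun a u v => by ext; simp; ring)
      (fun u v w => by ext; simp; ring)
      (fun a u v => by ext; simp; ring)
  let d : S →ₗ[F] S →ₗ[F] 𝔰 := g.compr₂ (B.toDual hB).symm.toLinearMap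
  have hd : ∀ X u v, B X (d u v) = c * f ⁅X, u⁆ v := fun X u v => by
    rw [hBcomm]
    exact LinearMap.BilinForm.apply_toDual_symm_apply (hB := hB) (g u v) X
  obtain ⟨δ, hδ⟩ := exists_lift hinj hr
  -- Both sides have the same pairing with every `1 ⊗ X`, so the inner derivations of vectors of `S`
  -- are defined over `F`.
  have hdδ : ∀ u v, (1 : K) ⊗ₜ[F] d u v = δ (1 ⊗ₜ u) (1 ⊗ₜ v) := fun u v => by
    refine sub_eq_zero.1 (hzero _ fun X => ?_)
    rw [map_sub, killingTraceForm_baseChange, ← hBdef, hd, killingTraceForm_lift hinj hr hδ hP,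
      map_mul, hf, LieAlgebra.ExtendScalars.bracket_tmul, mul_one, Module.finrank_baseChange]
    simp [c, map_ofNat (algebraMap F K)]
  have htriple : ∀ u v w, (1 : K) ⊗ₜ[F] ⁅d u v, w⁆ = P.triple (1 ⊗ₜ u) (1 ⊗ₜ v) (1 ⊗ₜ w) :=
    fun u v w => by
      rw [← hδ, ← hdδ, LieModule.toEnd_apply_apply, LieAlgebra.ExtendScalars.bracket_tmul, mul_one]
  have hfd : ∀ X u v, f ⁅X, u⁆ v = -f u ⁅X, v⁆ := fun X u v => by
    apply (algebraMap F K).injective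
    have h := form_lie hr ((1 : K) ⊗ₜ[F] X) (1 ⊗ₜ u) (1 ⊗ₜ v)
    simp only [LieAlgebra.ExtendScalars.bracket_tmul, mul_one] at h
    rw [map_neg, hf, hf, h]
  have hfN : ∀ u, (∀ v, f u v = 0) → u = 0 := by
    refine fun u hu => hι ?_
    simp only [TensorProduct.tmul_zero]
    refine hP.1 _ fun y => ?_
    induction y using TensorProduct.induction_on with
    | zero => simp
    | tmul a v =>
      rw [← mul_one a, ← smul_eq_mul, ← TensorProduct.smul_tmul', map_smul, ← hf, hu, map_zero,
        smul_zero]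
    | add x y hx hy => rw [map_add, hx, hy, add_zero]
  let Q : SymplecticTripleSystem F S :=
    { form := f
      triple := d.compr₂ (LieHom.toLinearMap (LieModule.toEnd F 𝔰 S))
      form_alt := fun u => (algebraMap F K).injective (by rw [hf, P.form_alt, map_zero])
      form_ne_zero := fun h => P.form_ne_zero <| bilin_ext fun u v => by
        rw [← hf, h]; simp
      triple_symm := fun x y z => hι (by
        simp [htriple, P.triple_symm (1 ⊗ₜ x) (1 ⊗ₜ y)])
      triple_sub := fun x y z => hι (by
        have h := P.triple_sub (1 ⊗ₜ x) (1 ⊗ₜ y) (1 ⊗ₜ z)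
        rw [← hf, ← hf, ← hf] at h
        have h2 : (2 : K) = algebraMap F K 2 := (map_ofNat (algebraMap F K) 2).symm
        rw [h2, ← map_mul, algebraMap_smul, algebraMap_smul, algebraMap_smul] at h
        simpa [TensorProduct.tmul_sub, TensorProduct.tmul_add, htriple] using h)
      triple_derivation := fun x y u v w => hι (by
        simpa [TensorProduct.tmul_add, htriple] using
          P.triple_derivation (1 ⊗ₜ x) (1 ⊗ₜ y) (1 ⊗ₜ u) (1 ⊗ₜ v) (1 ⊗ₜ w))
      triple_skew := fun x y u v => hfd (d x y) u v }
  refine ⟨Q, rfl, form_nondegenerate (LinearMap.ker_eq_bot'.2 fun u hu =>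
    hfN u fun v => LinearMap.congr_fun hu v), ?_⟩
  -- A functional vanishing on the span is `B Y` for some `Y`; then `f ⁅Y, u⁆ v = 0` for all `u, v`,
  -- and faithfulness forces `Y = 0`.
  have hspan : Submodule.span F {X | ∃ u v : S, X = d u v} = ⊤ := by
    by_contra h
    obtain ⟨p, hp0, hp⟩ := Submodule.exists_le_ker_of_lt_top _ (lt_top_iff_ne_top.2 h)
    obtain ⟨Y, rfl⟩ := (B.toDual hB).surjective p
    have hY : ∀ u : S, ⁅Y, u⁆ = 0 := fun u => hfN _ fun v => by
      have : B Y (d u v) = 0 := hp (Submodule.subset_span ⟨u, v, rfl⟩)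
      rw [hd] at this
      exact (mul_eq_zero.1 this).resolve_left hc
    refine hp0 ?_
    rw [hinj' (a₁ := Y) (a₂ := 0) (by ext u; simp [hY]), map_zero]
  have hQspan : Q.innerSpan = (Submodule.span F {X | ∃ u v : S, X = d u v}).map
      (LieHom.toLinearMap (LieModule.toEnd F 𝔰 S)) := by
    rw [Submodule.map_span]
    refine congrArg _ (Set.ext fun D => ⟨?_, ?_⟩)
    · rintro ⟨u, v, rfl⟩
      exact ⟨_, ⟨u, v, rfl⟩, rfl⟩
    · rintro ⟨_, ⟨u, v, rfl⟩, rfl⟩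
      exact ⟨u, v, rfl⟩
  ext D
  change D ∈ Q.innerSpan ↔ _
  rw [hQspan, hspan]
  simp

end Descent

end SymplecticTripleSystem

/-! ### The main theorem -/

open SymplecticTripleSystem in
theorem mainTheorem5
    {F K T 𝔰 S : Type*} [Field F] [CharZero F] [Field K] [Algebra F K] [IsAlgClosure F K]
    [AddCommGroup T] [Module K T] [FiniteDimensional K T]
    (P : SymplecticTripleSystem K T) (hP : P.IsSimple)
    [LieRing 𝔰] [LieAlgebra F 𝔰]
    [AddCommGroup S] [Module F S] [LieRingModule 𝔰 S] [LieModule F 𝔰 S]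
    (φ : (K ⊗[F] 𝔰) ≃ₗ⁅K⁆ P.inder)
    (Φ : (K ⊗[F] S) ≃ₗ[K] T)
    (hΦ : ∀ (x : K ⊗[F] 𝔰) (u : K ⊗[F] S),
      Φ ⁅x, u⁆ = (φ x : Module.End K T) (Φ u)) :
    ∃ Q : SymplecticTripleSystem F S,
      Q.form.Nondegenerate ∧
      Q.inder = (LieModule.toEnd F 𝔰 S).range ∧
      ∀ Q' : SymplecticTripleSystem F S,
        Q'.inder = (LieModule.toEnd F 𝔰 S).range ↔
          ∃ α : F, α ≠ 0 ∧ Q'.form = α • Q.form ∧ Q'.triple = α • Q.triple := by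
  have : IsAlgClosed K := IsAlgClosure.isAlgClosed F
  have : CharZero K := charZero_of_injective_algebraMap (algebraMap F K).injective
  have : FiniteDimensional K (K ⊗[F] 𝔰) := Module.Finite.equiv φ.toLinearEquiv.symm
  have : FiniteDimensional K (K ⊗[F] S) := Module.Finite.equiv Φ.symm
  have : FiniteDimensional F 𝔰 := .of_finite_tensorProduct_of_faithfullyFlat K
  have : FiniteDimensional F S := .of_finite_tensorProduct_of_faithfullyFlat K
  have hend : ∀ x, LieModule.toEnd K (K ⊗[F] 𝔰) (K ⊗[F] S) x = Φ.symm.conj (φ x : Module.End K T) := by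
    intro x
    refine LinearMap.ext fun u => Φ.injective ?_
    rw [LieModule.toEnd_apply_apply, hΦ]
    simp [LinearEquiv.conj_apply]
  have hinj : Function.Injective (LieModule.toEnd K (K ⊗[F] 𝔰) (K ⊗[F] S)) := fun x y h => by
    rw [hend, hend] at h
    exact φ.injective (Subtype.ext (Φ.symm.conj.injective h))
  have hN : (P.comap Φ).form.Nondegenerate := form_nondegenerate (ker_form_comap Φ hP.ker_form)
  have hr : (P.comap Φ).inder = (LieModule.toEnd K (K ⊗[F] 𝔰) (K ⊗[F] S)).range := by
    ext D
    change D ∈ (P.comap Φ).innerSpan ↔ _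
    rw [innerSpan_comap, LieHom.mem_range]
    constructor
    · rintro ⟨E, hE, rfl⟩
      exact ⟨φ.symm ⟨E, hE⟩, by rw [hend, φ.apply_symm_apply]; rfl⟩
    · rintro ⟨x, rfl⟩
      exact ⟨_, (φ x).2, (hend x).symm⟩
  obtain ⟨f, c, hc, hf, hfc⟩ := exists_smul_form_mem hN hr
  have hN' : ((P.comap Φ).smul c hc).form.Nondegenerate :=
    form_nondegenerate (by rw [smul_form, LinearMap.ker_smul _ _ hc, hN.ker_eq_bot])
  obtain ⟨Q, hQf, hQN, hQr⟩ := exists_descent hN' hinj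
    ((inder_eq_of_smul hc rfl).trans hr) f fun u v => by rw [hfc]; rfl
  refine ⟨Q, hQN, hQr, fun Q' => ⟨fun hQ' => ?_, ?_⟩⟩
  · obtain ⟨c', hc'⟩ := exists_algebraMap_eq_mul_form hN hr Q'.form Q'.form_alt
      fun X u v => form_lie hQ' X u v
    obtain ⟨u₀, v₀, h₀⟩ : ∃ u v, Q.form u v ≠ 0 := by
      by_contra! h
      exact Q.form_ne_zero (LinearMap.ext₂ h)
    -- The proportionality factor is a priori in `K`; as a ratio of two values in `F` it lies in
    -- `F`.
    have hform : Q'.form = (Q'.form u₀ v₀ / Q.form u₀ v₀) • Q.form := by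
      ext u v
      rw [LinearMap.smul_apply, LinearMap.smul_apply, smul_eq_mul, div_mul_eq_mul_div,
        eq_div_iff h₀]
      apply (algebraMap F K).injective
      rw [hQf, map_mul, map_mul, hfc, hfc, hc', hc']
      ring
    have hα : Q'.form u₀ v₀ / Q.form u₀ v₀ ≠ 0 := fun h => by
      rw [h, zero_smul] at hform
      exact Q'.form_ne_zero hform
    exact ⟨_, hα, hform, triple_eq_smul_of_form_eq_smul (toEnd_injective_of_baseChange hinj) hQr hQN
      hQ' hform hα⟩
  · rintro ⟨α, hα, -, h⟩
    rw [inder_eq_of_smul hα h, hQr]
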